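/- A qustring of length $n$ is a unit vector $|\phi\rangle$ of $(\mathbb{C}^2)^{\otimes n}$, and $\Phi_n$ denotes the set of all of them. For a permutation $\sigma$ of $\{1,\dots,n\}$ and $|\phi\rangle=\sum_{x\in\{0,1\}^n}\alpha_x|x_1x_2\cdots x_n\rangle$ put $\sigma(|\phi\rangle)=\sum_{x}\alpha_x|x_{\sigma(1)}x_{\sigma(2)}\cdots x_{\sigma(n)}\rangle$. A qustring $|\phi\rangle\in\Phi_n$ is $k$-separable if $\sigma(|\phi\rangle)=|\phi_1\rangle\otimes\cdots\otimes|\phi_k\rangle$ for some permutation $\sigma$ and some qustrings $|\phi_1\rangle,\dots,|\phi_k\rangle$ of lengths at least $1$. Put $\|X\|_{\mathrm{tr}}=\frac12\mathrm{Tr}\sqrt{X^\dagger X}$. The $k$-separability distance $\mathrm{sdis}_k(|\xi\rangle)$ of $|\xi\rangle\in\Phi_n$ is the infimum of $\big\||\xi\rangle\langle\xi|-|\phi\rangle\langle\phi|\big\|_{\mathrm{tr}}$ over all $k$-separable $|\phi\rangle\in\Phi_n$. Let $S(\rho)=-\mathrm{Tr}(\rho\log\rho)$ be the von Neumann entropy.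 For $n\ge 2$ and $|\psi\rangle\in\Phi_n$ the average entropy is $$E(|\psi\rangle\langle\psi|)=\frac{1}{n-1}\sum_{i=2}^{n}S\big(\mathrm{Tr}_{\mathcal{H}_{\ge i}}(|\psi\rangle\langle\psi|)\big),$$ where $\mathrm{Tr}_{\mathcal{H}_{\ge i}}$ is the partial trace over the qubits $i,i+1,\dots,n$. All logarithms are to base $2$, and $0\log 0=0$. **Lemma.** Let $n\ge 2$, let $|\xi\rangle\in\Phi_n$ and let $k\in\{2,3,\dots,n\}$. If $\mathrm{sdis}_k(|\xi\rangle)\le 1/e$, then $$\min_{|\phi\rangle}\big|E(|\xi\rangle\langle\xi|)-E(|\phi\rangle\langle\phi|)\big|\le \mathrm{sdis}_k(|\xi\rangle)\,\big(n-\log \mathrm{sdis}_k(|\xi\rangle)\big),$$ where $|\phi\rangle$ ranges over all $k$-separable qustrings in $\Phi_n$. In particular, the minimum is attained. -/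

import Mathlib

open scoped Matrix

noncomputable section

/-- The Hilbert space of `n` qubits; the computational basis is indexed by the binary strings
`x : Fin n → Bool` of length `n`. -/
abbrev QubitSpace (n : ℕ) : Type := EuclideanSpace ℂ (Fin n → Bool)

/-- Qustrings of length `n`: unit vectors of the `n`-qubit space. -/
abbrev Qustring (n : ℕ) : Type := Metric.sphere (0 : QubitSpace n) 1

/-- The vector `∑ x, α x |x_{σ(1)} ⋯ x_{σ(n)}⟩`, where `φ = ∑ x, α x |x_1 ⋯ x_n⟩`: its amplitude
at the string `y` is the amplitude of `φ` at the string `x` with `y = x ∘ σ`. -/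
def permuteQubits {n : ℕ} (σ : Equiv.Perm (Fin n)) (φ : QubitSpace n) : QubitSpace n :=
  WithLp.toLp 2 fun y => φ (fun i => y (σ.symm i))

/-- The tensor product `φ_1 ⊗ ⋯ ⊗ φ_k` of vectors on `m_1, …, m_k` qubits, as a vector on
`n = m_1 + ⋯ + m_k` qubits. Its amplitude at the concatenation of strings `y_1, …, y_k` of lengths
`m_1, …, m_k` is the product of the amplitudes of `φ_j` at `y_j`; `finSigmaFinEquiv` numbers the
positions of the concatenation consecutively. -/
def tensorBlocks {n k : ℕ} (m : Fin k → ℕ) (hm : ∑ j, m j = n) (φ : ∀ j, QubitSpace (m j)) :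
    QubitSpace n :=
  WithLp.toLp 2 fun y => ∏ j, φ j (fun t => y (Fin.cast hm (finSigmaFinEquiv ⟨j, t⟩)))

/-- `φ` is `k`-separable: some permutation of its qubits turns it into a tensor product of
`k` qustrings of positive lengths. -/
def IsKSeparable {n : ℕ} (k : ℕ) (φ : Qustring n) : Prop :=
  ∃ (m : Fin k → ℕ) (hm : ∑ j, m j = n) (ψ : ∀ j, Qustring (m j)) (σ : Equiv.Perm (Fin n)),
    (∀ j, 1 ≤ m j) ∧
      permuteQubits σ (φ : QubitSpace n) = tensorBlocks m hm (fun j => (ψ j : QubitSpace (m j)))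

/-- The density matrix `|φ⟩⟨φ|`. -/
def ketbra {n : ℕ} (φ : Qustring n) : Matrix (Fin n → Bool) (Fin n → Bool) ℂ :=
  Matrix.of fun x y => (φ : QubitSpace n) x * star ((φ : QubitSpace n) y)

/-- The normalized trace norm `(1/2) Tr √(X† X)`; the square root is taken in the functional
calculus of Hermitian matrices. -/
def trNorm {ι : Type*} [Fintype ι] [DecidableEq ι] (X : Matrix ι ι ℂ) : ℝ :=
  1 / 2 * (Matrix.trace (cfc Real.sqrt (Xᴴ * X))).re

/-- The `k`-separability distance of `ξ`. -/
def sdis {n : ℕ} (k : ℕ) (ξ : Qustring n) : ℝ :=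
  sInf {d : ℝ | ∃ φ : Qustring n, IsKSeparable k φ ∧ d = trNorm (ketbra ξ - ketbra φ)}

/-- The von Neumann entropy `-Tr (ρ log₂ ρ)`. (`Real.logb 2 0 = 0`, so a zero eigenvalue of `ρ`
contributes `0`, as usual.) -/
def vonNeumannEntropy {ι : Type*} [Fintype ι] [DecidableEq ι] (ρ : Matrix ι ι ℂ) : ℝ :=
  -(Matrix.trace (ρ * cfc (Real.logb 2) ρ)).re

/-- The partial trace over the second factor of a bipartite system. -/
def partialTraceRight {α β : Type*} [Fintype β] (ρ : Matrix (α × β) (α × β) ℂ) : Matrix α α ℂ :=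
  Matrix.of fun a a' => ∑ b, ρ (a, b) (a', b)

/-- The reduced state that remains after tracing out the qubits with numbers `i, i + 1, …, n`
(qubits are numbered from `1`, so `q : Fin n` is the qubit with number `q + 1`). -/
def traceOutFrom {n : ℕ} (i : ℕ) (ρ : Matrix (Fin n → Bool) (Fin n → Bool) ℂ) :
    Matrix ({q : Fin n // (q : ℕ) + 1 < i} → Bool) ({q : Fin n // (q : ℕ) + 1 < i} → Bool) ℂ :=
  partialTraceRight
    (Matrix.reindex
      (Equiv.piEquivPiSubtypeProd (fun q : Fin n => (q : ℕ) + 1 < i) fun _ => Bool)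
      (Equiv.piEquivPiSubtypeProd (fun q : Fin n => (q : ℕ) + 1 < i) fun _ => Bool) ρ)

/-- The average entropy of a qustring of length `n` with density matrix `ρ`. -/
def averageEntropy {n : ℕ} (ρ : Matrix (Fin n → Bool) (Fin n → Bool) ℂ) : ℝ :=
  1 / ((n : ℝ) - 1) * ∑ i ∈ Finset.Icc 2 n, vonNeumannEntropy (traceOutFrom i ρ)

end

/-!
Measuring a state `ρ` in an eigenbasis of `σ` does not lower its entropy, because the outcome
weights are the image of the spectrum of `ρ` under a doubly stochastic matrix. The Jordan
decomposition `ρ - σ = P - N` shows that half the `ℓ¹` distance of the two outcome distributions is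
at most `T = ‖ρ - σ‖_tr`. So, up to the factor `1 / log 2`, `S ρ - S σ` obeys the bound
`T * (log (d - 1) + 1) - T * log T` for probability vectors on `d` points. This bound is increasing
in `T ∈ [0, 1]`, hence survives the contraction of `T` by a partial trace. With `d = 2 ^ (i - 1)` it
is at most `T * (2 * (i - 1) - logb 2 T)`, and the average of `2 * (i - 1)` over `i = 2, …, n` is
`n`. Both the infimum defining `sdis` and the minimum in the theorem are attained because the
`k`-separable qustrings are a finite union of closed sets in the compact unit sphere.
-/

section RealEntropy

open Real

theorem negMulLog_add_le {x y : ℝ} (hx : 0 ≤ x) (hy : 0 ≤ y) :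
    negMulLog (x + y) ≤ negMulLog x + negMulLog y := by
  have mul_log_le {a b : ℝ} (ha : 0 ≤ a) (hb : 0 ≤ b) : a * log a ≤ a * log (a + b) := by
    rcases ha.eq_or_lt with rfl | ha
    · simp
    · gcongr
      linarith
  have hxy := mul_log_le hx hy
  have hyx := mul_log_le hy hx
  rw [add_comm y x] at hyx
  simp only [negMulLog]
  linarith

theorem monotoneOn_mul_add_negMulLog {c : ℝ} (hc : 1 ≤ c) :
    MonotoneOn (fun x => x * c + negMulLog x) (Set.Icc 0 1) := by
  refine monotoneOn_of_hasDerivWithinAt_nonneg (f' := fun x => 1 * c + (-log x - 1))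
    (convex_Icc 0 1) (by fun_prop) (fun x hx => ?_) fun x hx => ?_ <;>
    rw [interior_Icc] at hx
  · exact (((hasDerivAt_id' x).mul_const c).add (hasDerivAt_negMulLog hx.1.ne')).hasDerivWithinAt
  · linarith [log_nonpos hx.1.le hx.2.le]

theorem negMulLog_sub_le_negMulLog_sub {x y : ℝ} (hy : 0 ≤ y) (hyx : y ≤ x) :
    negMulLog x - negMulLog y ≤ negMulLog (x - y) := by
  have := negMulLog_add_le (sub_nonneg.2 hyx) hy
  rw [sub_add_cancel] at this
  linarith

theorem negMulLog_sub_le_sub {x y : ℝ} (hx : 0 ≤ x) (hxy : x ≤ y) (hy : y ≤ 1) :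
    negMulLog x - negMulLog y ≤ y - x := by
  have := monotoneOn_mul_add_negMulLog le_rfl ⟨hx, hxy.trans hy⟩ ⟨hx.trans hxy, hy⟩ hxy
  simp only [mul_one] at this
  linarith

theorem sum_negMulLog_le_mul_log_card_add {ι : Type*} {s : Finset ι} {r : ι → ℝ}
    (hr : ∀ i ∈ s, 0 ≤ r i) :
    ∑ i ∈ s, negMulLog (r i) ≤ (∑ i ∈ s, r i) * log s.card + negMulLog (∑ i ∈ s, r i) := by
  rcases s.eq_empty_or_nonempty with rfl | hs
  · simp
  have hcard : (0 : ℝ) < s.card := by exact_mod_cast hs.card_pos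
  have jensen := concaveOn_negMulLog.le_map_sum (t := s) (w := fun _ => (s.card : ℝ)⁻¹) (p := r)
    (fun _ _ => by positivity) (by simp [hcard.ne']) hr
  simp only [smul_eq_mul, ← Finset.mul_sum] at jensen
  rw [negMulLog_mul, inv_mul_le_iff₀ hcard] at jensen
  refine jensen.trans_eq ?_
  simp only [negMulLog, log_inv]
  field_simp

theorem sum_filter_pos_eq_half_sum_abs {ι : Type*} [Fintype ι] {r : ι → ℝ} (hr : ∑ i, r i = 0) :
    ∑ i with 0 < r i, r i = 1 / 2 * ∑ i, |r i| := by
  have pos_part_eq (x : ℝ) : (if 0 < x then x else 0) = 1 / 2 * (|x| + x) := by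
    split_ifs with hx
    · rw [abs_of_pos hx]; ring
    · rw [abs_of_nonpos (not_lt.1 hx)]; ring
  simp only [Finset.sum_filter, pos_part_eq, ← Finset.mul_sum, Finset.sum_add_distrib, hr, add_zero]

theorem card_filter_pos_le {ι : Type*} [Fintype ι] {r : ι → ℝ} (hr : ∑ i, r i ≤ 0) :
    (Finset.univ.filter fun i => 0 < r i).card ≤ Fintype.card ι - 1 := by
  rcases isEmpty_or_nonempty ι with _ | _
  · simp
  · obtain ⟨i, -, hi⟩ := Finset.exists_le_of_sum_le (Finset.univ_nonempty (α := ι))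
      (hr.trans_eq Finset.sum_const_zero.symm)
    exact Nat.le_sub_one_of_lt (Finset.card_lt_univ_of_notMem (x := i) (by simpa using hi))

theorem sum_negMulLog_sub_le {ι : Type*} [Fintype ι] {p q : ι → ℝ} (hp : p ∈ stdSimplex ℝ ι)
    (hq : q ∈ stdSimplex ℝ ι) :
    ∑ i, negMulLog (p i) - ∑ i, negMulLog (q i) ≤
      1 / 2 * (∑ i, |p i - q i|) * (log (Fintype.card ι - 1 : ℕ) + 1) +
        negMulLog (1 / 2 * ∑ i, |p i - q i|) := by
  set T := 1 / 2 * ∑ i, |p i - q i|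
  set s : Finset ι := {i | 0 < p i - q i}
  have hzero : ∑ i, (p i - q i) = 0 := by rw [Finset.sum_sub_distrib, hp.2, hq.2, sub_self]
  have hsT : ∑ i ∈ s, (p i - q i) = T := sum_filter_pos_eq_half_sum_abs hzero
  have hscT : ∑ i with ¬ 0 < p i - q i, (q i - p i) = T := by
    rw [← Finset.sum_filter_add_sum_filter_not _ fun i => 0 < p i - q i, hsT] at hzero
    simp only [← neg_sub (p _), Finset.sum_neg_distrib]
    linarith
  calc ∑ i, negMulLog (p i) - ∑ i, negMulLog (q i)
      ≤ ∑ i ∈ s, negMulLog (p i - q i) + T := by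
        rw [← Finset.sum_sub_distrib, ← hscT,
          ← Finset.sum_filter_add_sum_filter_not _ fun i => 0 < p i - q i]
        refine add_le_add (Finset.sum_le_sum fun i hi => ?_) (Finset.sum_le_sum fun i hi => ?_) <;>
          rw [Finset.mem_filter_univ] at hi
        · exact negMulLog_sub_le_negMulLog_sub (hq.1 i) (by linarith)
        · exact negMulLog_sub_le_sub (hp.1 i) (by linarith) (stdSimplex.le_one ⟨q, hq⟩ i)
    _ ≤ T * log s.card + negMulLog T + T := by
        rw [← hsT]
        gcongr
        exact sum_negMulLog_le_mul_log_card_add fun i hi => (Finset.mem_filter_univ i |>.1 hi).le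
    _ ≤ T * log (Fintype.card ι - 1 : ℕ) + negMulLog T + T := by
        gcongr T * ?_ + _ + _
        rcases s.card.eq_zero_or_pos with h | h
        · simpa only [h, Nat.cast_zero, log_zero] using log_natCast_nonneg _
        · have := card_filter_pos_le hzero.le
          gcongr
    _ = T * (log (Fintype.card ι - 1 : ℕ) + 1) + negMulLog T := by ring

theorem log_two_pow_sub_one_add_one_le {m : ℕ} (hm : 1 ≤ m) :
    log (2 ^ m - 1 : ℕ) + 1 ≤ 2 * m * log 2 := by
  have hlog2 : 1 / 2 < log 2 := by linarith [log_two_gt_d9]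
  rcases hm.eq_or_lt with rfl | hm
  · norm_num
    linarith
  have hm2 : (2 : ℝ) ≤ m := by exact_mod_cast hm
  have hpow : 1 < 2 ^ m := Nat.one_lt_two_pow (by omega)
  have hle : log (2 ^ m - 1 : ℕ) ≤ m * log 2 := calc
    log (2 ^ m - 1 : ℕ) ≤ log (2 ^ m : ℕ) := by
      gcongr
      · exact_mod_cast Nat.sub_pos_of_lt hpow
      · omega
    _ = m * log 2 := by simp
  nlinarith

theorem sum_comp_le_sum_comp_mulVec {ι : Type*} [Fintype ι] [DecidableEq ι] {M : Matrix ι ι ℝ}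
    (hM : M ∈ doublyStochastic ℝ ι) {s : Set ℝ} {f : ℝ → ℝ} (hf : ConcaveOn ℝ s f) {x : ι → ℝ}
    (hx : ∀ j, x j ∈ s) : ∑ j, f (x j) ≤ ∑ i, f ((M *ᵥ x) i) := by
  obtain ⟨hM0, hrow, hcol⟩ := mem_doublyStochastic_iff_sum.1 hM
  calc ∑ j, f (x j) = ∑ i, ∑ j, M i j * f (x j) := by
        rw [Finset.sum_comm]
        simp only [← Finset.sum_mul, hcol, one_mul]
    _ ≤ ∑ i, f ((M *ᵥ x) i) := Finset.sum_le_sum fun i _ => by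
        simpa only [smul_eq_mul, Matrix.mulVec, dotProduct] using
          hf.le_map_sum (fun j _ => hM0 i j) (hrow i) fun j _ => hx j

end RealEntropy

open scoped ComplexOrder

section Spectral

variable {ι : Type*} [Fintype ι] [DecidableEq ι]

theorem continuousOn_spectrum (A : Matrix ι ι ℂ) (f : ℝ → ℝ) : ContinuousOn f (spectrum ℝ A) :=
  (Matrix.finite_real_spectrum (A := A)).continuousOn f

theorem trace_cfc {A : Matrix ι ι ℂ} (hA : A.IsHermitian) (f : ℝ → ℝ) :
    (cfc f A).trace = ∑ i, f (hA.eigenvalues i) := by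
  rw [hA.cfc_eq, Matrix.IsHermitian.cfc, Unitary.conjStarAlgAut_apply, Matrix.trace_mul_comm,
    ← mul_assoc]
  simp [Matrix.trace]

open scoped MatrixOrder in
theorem posSemidef_cfc {f : ℝ → ℝ} (hf : ∀ x, 0 ≤ f x) (A : Matrix ι ι ℂ) :
    (cfc f A).PosSemidef :=
  Matrix.nonneg_iff_posSemidef.1 (cfc_nonneg fun x _ => hf x)

theorem trNorm_nonneg (X : Matrix ι ι ℂ) : 0 ≤ trNorm X :=
  mul_nonneg (by norm_num)
    (Complex.le_def.1 (posSemidef_cfc Real.sqrt_nonneg (Xᴴ * X)).trace_nonneg).1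

theorem trNorm_sub_comm (X Y : Matrix ι ι ℂ) : trNorm (X - Y) = trNorm (Y - X) := by
  rw [trNorm, trNorm, ← neg_sub Y X, Matrix.conjTranspose_neg, neg_mul_neg]

theorem trNorm_eq_sum_abs_eigenvalues {X : Matrix ι ι ℂ} (hX : X.IsHermitian) :
    trNorm X = 1 / 2 * ∑ i, |hX.eigenvalues i| := by
  have hsq : Xᴴ * X = cfc (fun x : ℝ => x ^ 2) X := by
    rw [hX.eq, cfc_pow_id X 2 hX.isSelfAdjoint, sq]
  rw [trNorm, hsq, ← cfc_comp' Real.sqrt (fun x : ℝ => x ^ 2) X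
    ((Matrix.finite_real_spectrum.image _).continuousOn _) (continuousOn_spectrum X _)
    hX.isSelfAdjoint, trace_cfc hX]
  simp only [Real.sqrt_sq_eq_abs, Complex.ofReal_re]

theorem vonNeumannEntropy_eq_trace_cfc {ρ : Matrix ι ι ℂ} (hρ : ρ.IsHermitian) :
    vonNeumannEntropy ρ = (cfc Real.negMulLog ρ).trace.re / Real.log 2 := by
  have hmul : ρ * cfc (Real.logb 2) ρ = cfc (fun x => x * Real.logb 2 x) ρ := by
    rw [cfc_mul (fun x => x) (Real.logb 2) ρ (continuousOn_spectrum ρ _)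
      (continuousOn_spectrum ρ _), cfc_id' ℝ ρ hρ.isSelfAdjoint]
  simp only [vonNeumannEntropy, hmul, trace_cfc hρ, Complex.ofReal_re,
    Finset.sum_div, ← Finset.sum_neg_distrib, Real.negMulLog, Real.logb, mul_div_assoc, neg_mul,
    neg_div]

theorem vonNeumannEntropy_eq_sum_eigenvalues {ρ : Matrix ι ι ℂ} (hρ : ρ.IsHermitian) :
    vonNeumannEntropy ρ = (∑ i, Real.negMulLog (hρ.eigenvalues i)) / Real.log 2 := by
  rw [vonNeumannEntropy_eq_trace_cfc hρ, trace_cfc hρ, Complex.ofReal_re]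

theorem exists_jordan_decomposition {X : Matrix ι ι ℂ} (hX : X.IsHermitian) :
    ∃ P N : Matrix ι ι ℂ, P.PosSemidef ∧ N.PosSemidef ∧ P - N = X ∧
      trNorm X = 1 / 2 * (P.trace.re + N.trace.re) := by
  refine ⟨cfc (·⁺) X, cfc (·⁻) X, posSemidef_cfc posPart_nonneg X,
    posSemidef_cfc negPart_nonneg X, ?_, ?_⟩
  · rw [← cfc_sub _ _ X (continuousOn_spectrum X _) (continuousOn_spectrum X _)]
    simp only [posPart_sub_negPart]
    exact cfc_id' ℝ X hX.isSelfAdjoint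
  · simp only [trNorm_eq_sum_abs_eigenvalues hX, trace_cfc hX, Complex.ofReal_re,
      ← Finset.sum_add_distrib, posPart_add_negPart]

theorem map_norm_sq_mem_doublyStochastic (U : Matrix.unitaryGroup ι ℂ) :
    (U : Matrix ι ι ℂ).map (‖·‖ ^ 2) ∈ doublyStochastic ℝ ι := by
  have row_sum (V : Matrix.unitaryGroup ι ℂ) (i : ι) : ∑ j, ‖V i j‖ ^ 2 = 1 := by
    have := congrFun₂ (Matrix.mem_unitaryGroup_iff.1 V.2) i i
    simp only [Matrix.mul_apply, Matrix.star_apply, RCLike.star_def, Complex.mul_conj',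
      Matrix.one_apply_eq] at this
    exact_mod_cast this
  refine mem_doublyStochastic_iff_sum.2 ⟨fun i j => by simp, row_sum U, fun j => ?_⟩
  simpa [Matrix.star_apply] using row_sum (star U) j

end Spectral

section Measurement

variable {ι : Type*} [Fintype ι] [DecidableEq ι]

/-- The outcome weights `⟨vᵢ|A|vᵢ⟩` of measuring `A` in the orthonormal basis of the columns `vᵢ`
of the unitary matrix `V`. For a density matrix `A` they form a probability vector. -/
def measurementWeight (V : Matrix.unitaryGroup ι ℂ) (A : Matrix ι ι ℂ) (i : ι) : ℝ :=
  ((star V.1 * A * V.1) i i).re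

theorem measurementWeight_sub (V : Matrix.unitaryGroup ι ℂ) (A B : Matrix ι ι ℂ) (i : ι) :
    measurementWeight V (A - B) i = measurementWeight V A i - measurementWeight V B i := by
  simp only [measurementWeight, mul_sub, sub_mul, Matrix.sub_apply, Complex.sub_re]

theorem measurementWeight_nonneg (V : Matrix.unitaryGroup ι ℂ) {A : Matrix ι ι ℂ}
    (hA : A.PosSemidef) (i : ι) : 0 ≤ measurementWeight V A i :=
  (Complex.le_def.1 (hA.conjTranspose_mul_mul_same V.1).diag_nonneg).1

theorem sum_measurementWeight (V : Matrix.unitaryGroup ι ℂ) (A : Matrix ι ι ℂ) :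
    ∑ i, measurementWeight V A i = A.trace.re := by
  have htrace : (star V.1 * A * V.1).trace = A.trace := by
    rw [Matrix.trace_mul_comm, ← mul_assoc, Matrix.mem_unitaryGroup_iff.1 V.2, one_mul]
  rw [← htrace, Matrix.trace, Complex.re_sum]
  rfl

theorem measurementWeight_eigenvectorUnitary {A : Matrix ι ι ℂ} (hA : A.IsHermitian) :
    measurementWeight hA.eigenvectorUnitary A = hA.eigenvalues := by
  ext i
  have := congrFun₂ hA.conjStarAlgAut_star_eigenvectorUnitary i i
  rw [Unitary.conjStarAlgAut_star_apply] at this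
  simp [measurementWeight, this]

theorem measurementWeight_eq_mulVec_eigenvalues (V : Matrix.unitaryGroup ι ℂ) {A : Matrix ι ι ℂ}
    (hA : A.IsHermitian) :
    measurementWeight V A =
      ((star V * hA.eigenvectorUnitary : Matrix.unitaryGroup ι ℂ).1.map (‖·‖ ^ 2)) *ᵥ
        hA.eigenvalues := by
  ext i
  set W : Matrix.unitaryGroup ι ℂ := star V * hA.eigenvectorUnitary with hW
  have hconj : star V.1 * A * V.1 =
      W.1 * Matrix.diagonal (RCLike.ofReal ∘ hA.eigenvalues) * star W.1 := by
    conv_lhs => rw [hA.spectral_theorem, Unitary.conjStarAlgAut_apply]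
    simp [hW, mul_assoc]
  rw [measurementWeight, hconj, Matrix.mul_apply, Complex.re_sum, Matrix.mulVec, dotProduct]
  refine Finset.sum_congr rfl fun j _ => ?_
  rw [Matrix.mul_diagonal, Matrix.star_apply, RCLike.star_def, mul_right_comm, Complex.mul_conj',
    Function.comp_apply]
  norm_cast
  exact Complex.re_ofReal_mul _ _

theorem sum_negMulLog_eigenvalues_le (V : Matrix.unitaryGroup ι ℂ) {A : Matrix ι ι ℂ}
    (hA : A.PosSemidef) :
    ∑ i, Real.negMulLog (hA.1.eigenvalues i) ≤ ∑ i, Real.negMulLog (measurementWeight V A i) := by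
  rw [measurementWeight_eq_mulVec_eigenvalues V hA.1]
  exact sum_comp_le_sum_comp_mulVec (map_norm_sq_mem_doublyStochastic _) Real.concaveOn_negMulLog
    hA.eigenvalues_nonneg

theorem sum_abs_measurementWeight_sub_le (V : Matrix.unitaryGroup ι ℂ) {P N : Matrix ι ι ℂ}
    (hP : P.PosSemidef) (hN : N.PosSemidef) :
    ∑ i, |measurementWeight V (P - N) i| ≤ P.trace.re + N.trace.re := by
  rw [← sum_measurementWeight V, ← sum_measurementWeight V,
    ← Finset.sum_add_distrib]
  refine Finset.sum_le_sum fun i _ => ?_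
  have hPi := measurementWeight_nonneg V hP i
  have hNi := measurementWeight_nonneg V hN i
  rw [measurementWeight_sub, abs_le]
  constructor <;> linarith

theorem half_sum_abs_measurementWeight_le_trNorm (V : Matrix.unitaryGroup ι ℂ) {X : Matrix ι ι ℂ}
    (hX : X.IsHermitian) : 1 / 2 * ∑ i, |measurementWeight V X i| ≤ trNorm X := by
  obtain ⟨P, N, hP, hN, rfl, htr⟩ := exists_jordan_decomposition hX
  rw [htr]
  gcongr
  exact sum_abs_measurementWeight_sub_le V hP hN

theorem trNorm_sub_le_of_posSemidef {P N : Matrix ι ι ℂ} (hP : P.PosSemidef) (hN : N.PosSemidef) :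
    trNorm (P - N) ≤ 1 / 2 * (P.trace.re + N.trace.re) := by
  have hX := hP.1.sub hN.1
  rw [trNorm_eq_sum_abs_eigenvalues hX, ← measurementWeight_eigenvectorUnitary hX]
  gcongr
  exact sum_abs_measurementWeight_sub_le _ hP hN

end Measurement

section DensityMatrix

/-- Density matrices: positive semidefinite matrices of trace one, the (mixed) states of a quantum
system with basis indexed by `ι`. -/
structure IsDensityMatrix {ι : Type*} [Fintype ι] (ρ : Matrix ι ι ℂ) : Prop where
  posSemidef : ρ.PosSemidef
  trace_eq_one : ρ.trace = 1

variable {ι : Type*} [Fintype ι] [DecidableEq ι] {ρ σ : Matrix ι ι ℂ}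

namespace IsDensityMatrix

theorem measurementWeight_mem_stdSimplex (V : Matrix.unitaryGroup ι ℂ) (hρ : IsDensityMatrix ρ) :
    measurementWeight V ρ ∈ stdSimplex ℝ ι :=
  ⟨measurementWeight_nonneg V hρ.posSemidef, by
    rw [sum_measurementWeight, hρ.trace_eq_one, Complex.one_re]⟩

theorem trNorm_sub_le_one (hρ : IsDensityMatrix ρ) (hσ : IsDensityMatrix σ) :
    trNorm (ρ - σ) ≤ 1 := by
  refine (trNorm_sub_le_of_posSemidef hρ.posSemidef hσ.posSemidef).trans_eq ?_
  rw [hρ.trace_eq_one, hσ.trace_eq_one]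
  norm_num

theorem vonNeumannEntropy_sub_le (hρ : IsDensityMatrix ρ) (hσ : IsDensityMatrix σ) :
    vonNeumannEntropy ρ - vonNeumannEntropy σ ≤
      (trNorm (ρ - σ) * (Real.log (Fintype.card ι - 1 : ℕ) + 1) +
        Real.negMulLog (trNorm (ρ - σ))) / Real.log 2 := by
  set V := hσ.posSemidef.1.eigenvectorUnitary with hV
  set p := measurementWeight V ρ with hp
  set q := measurementWeight V σ with hq
  have hdist : 1 / 2 * ∑ i, |p i - q i| ≤ trNorm (ρ - σ) := by
    simp only [hp, hq, ← measurementWeight_sub]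
    exact half_sum_abs_measurementWeight_le_trNorm V (hρ.posSemidef.1.sub hσ.posSemidef.1)
  have hle_one := hρ.trNorm_sub_le_one hσ
  rw [vonNeumannEntropy_eq_sum_eigenvalues hρ.posSemidef.1,
    vonNeumannEntropy_eq_sum_eigenvalues hσ.posSemidef.1, ← sub_div,
    ← measurementWeight_eigenvectorUnitary hσ.posSemidef.1, ← hV, ← hq]
  gcongr
  calc ∑ i, Real.negMulLog (hρ.posSemidef.1.eigenvalues i) - ∑ i, Real.negMulLog (q i)
      ≤ ∑ i, Real.negMulLog (p i) - ∑ i, Real.negMulLog (q i) := by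
        gcongr ?_ - _
        exact sum_negMulLog_eigenvalues_le V hρ.posSemidef
    _ ≤ _ := sum_negMulLog_sub_le (hρ.measurementWeight_mem_stdSimplex V)
        (hσ.measurementWeight_mem_stdSimplex V)
    _ ≤ _ := monotoneOn_mul_add_negMulLog
        (by linarith [Real.log_natCast_nonneg (Fintype.card ι - 1)])
        ⟨by positivity, hdist.trans hle_one⟩ ⟨trNorm_nonneg _, hle_one⟩ hdist

end IsDensityMatrix

end DensityMatrix

section PartialTrace

theorem partialTraceRight_sub {α β : Type*} [Fintype β] (ρ σ : Matrix (α × β) (α × β) ℂ) :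
    partialTraceRight (ρ - σ) = partialTraceRight ρ - partialTraceRight σ := by
  ext a a'
  simp [partialTraceRight]

theorem trace_partialTraceRight {α β : Type*} [Fintype α] [Fintype β]
    (ρ : Matrix (α × β) (α × β) ℂ) : (partialTraceRight ρ).trace = ρ.trace := by
  simp [partialTraceRight, Matrix.trace, Fintype.sum_prod_type]

theorem posSemidef_partialTraceRight {α β : Type*} [Fintype β] {ρ : Matrix (α × β) (α × β) ℂ}
    (hρ : ρ.PosSemidef) : (partialTraceRight ρ).PosSemidef := by
  have hsum : partialTraceRight ρ = ∑ b, ρ.submatrix (·, b) (·, b) := by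
    ext a a'
    simp [partialTraceRight, Matrix.sum_apply]
  rw [hsum]
  exact Matrix.posSemidef_sum _ fun b _ => hρ.submatrix (·, b)

variable {n : ℕ} (i : ℕ)

theorem traceOutFrom_sub (ρ σ : Matrix (Fin n → Bool) (Fin n → Bool) ℂ) :
    traceOutFrom i (ρ - σ) = traceOutFrom i ρ - traceOutFrom i σ :=
  partialTraceRight_sub _ _

theorem trace_traceOutFrom (ρ : Matrix (Fin n → Bool) (Fin n → Bool) ℂ) :
    (traceOutFrom i ρ).trace = ρ.trace := by
  rw [traceOutFrom, trace_partialTraceRight, Matrix.reindex_apply, Matrix.trace, Matrix.trace]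
  exact Equiv.sum_comp _ ρ.diag

theorem posSemidef_traceOutFrom {ρ : Matrix (Fin n → Bool) (Fin n → Bool) ℂ} (hρ : ρ.PosSemidef) :
    (traceOutFrom i ρ).PosSemidef :=
  posSemidef_partialTraceRight (hρ.submatrix _)

theorem isHermitian_traceOutFrom {ρ : Matrix (Fin n → Bool) (Fin n → Bool) ℂ}
    (hρ : ρ.IsHermitian) : (traceOutFrom i ρ).IsHermitian := by
  obtain ⟨P, N, hP, hN, rfl, -⟩ := exists_jordan_decomposition hρ
  rw [traceOutFrom_sub]
  exact (posSemidef_traceOutFrom i hP).1.sub (posSemidef_traceOutFrom i hN).1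

theorem trNorm_traceOutFrom_le {X : Matrix (Fin n → Bool) (Fin n → Bool) ℂ} (hX : X.IsHermitian) :
    trNorm (traceOutFrom i X) ≤ trNorm X := by
  obtain ⟨P, N, hP, hN, rfl, htr⟩ := exists_jordan_decomposition hX
  rw [htr, traceOutFrom_sub, ← trace_traceOutFrom i P, ← trace_traceOutFrom i N]
  exact trNorm_sub_le_of_posSemidef (posSemidef_traceOutFrom i hP) (posSemidef_traceOutFrom i hN)

theorem card_prefix_strings {i : ℕ} (hi : i ≤ n) :
    Fintype.card ({q : Fin n // (q : ℕ) + 1 < i} → Bool) = 2 ^ (i - 1) := by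
  have hcard : Fintype.card {q : Fin n // (q : ℕ) + 1 < i} = i - 1 := by
    simp only [← Nat.lt_sub_iff_add_lt, Fintype.card_subtype, Fin.card_filter_val_lt]
    omega
  rw [Fintype.card_fun, Fintype.card_bool, hcard]

end PartialTrace

section AverageEntropy

variable {n : ℕ} {ρ σ : Matrix (Fin n → Bool) (Fin n → Bool) ℂ}

theorem isDensityMatrix_traceOutFrom (hρ : IsDensityMatrix ρ) (i : ℕ) :
    IsDensityMatrix (traceOutFrom i ρ) :=
  ⟨posSemidef_traceOutFrom i hρ.posSemidef, (trace_traceOutFrom i ρ).trans hρ.trace_eq_one⟩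

theorem sum_Icc_two_mul_sub_one (hn : 1 ≤ n) :
    ∑ i ∈ Finset.Icc 2 n, 2 * ((i : ℝ) - 1) = (n - 1) * n := by
  induction n, hn using Nat.le_induction with
  | base => simp
  | succ N hN ih =>
    rw [Finset.sum_Icc_succ_top (by omega), ih]
    push_cast
    ring

namespace IsDensityMatrix

theorem vonNeumannEntropy_traceOutFrom_sub_le (hρ : IsDensityMatrix ρ) (hσ : IsDensityMatrix σ)
    {i : ℕ} (hi : i ∈ Finset.Icc 2 n) :
    vonNeumannEntropy (traceOutFrom i ρ) - vonNeumannEntropy (traceOutFrom i σ) ≤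
      trNorm (ρ - σ) * (2 * ((i : ℝ) - 1) - Real.logb 2 (trNorm (ρ - σ))) := by
  obtain ⟨m, rfl⟩ : ∃ m, i = m + 1 := Nat.exists_eq_add_one.2 (by grind)
  obtain ⟨hm, hmn⟩ := Finset.mem_Icc.1 hi
  have hfannes := (isDensityMatrix_traceOutFrom hρ (m + 1)).vonNeumannEntropy_sub_le
    (isDensityMatrix_traceOutFrom hσ (m + 1))
  rw [← traceOutFrom_sub, card_prefix_strings hmn, Nat.add_sub_cancel] at hfannes
  set t := trNorm (traceOutFrom (m + 1) (ρ - σ))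
  set T := trNorm (ρ - σ)
  have htT : t ≤ T := trNorm_traceOutFrom_le _ (hρ.posSemidef.1.sub hσ.posSemidef.1)
  have hT0 : 0 ≤ T := trNorm_nonneg _
  have hT1 : T ≤ 1 := hρ.trNorm_sub_le_one hσ
  calc vonNeumannEntropy (traceOutFrom (m + 1) ρ) -
        vonNeumannEntropy (traceOutFrom (m + 1) σ)
      ≤ (t * (Real.log (2 ^ m - 1 : ℕ) + 1) + Real.negMulLog t) / Real.log 2 := hfannes
    _ ≤ (T * (Real.log (2 ^ m - 1 : ℕ) + 1) + Real.negMulLog T) / Real.log 2 := by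
        gcongr ?_ / _
        exact monotoneOn_mul_add_negMulLog (by linarith [Real.log_natCast_nonneg (2 ^ m - 1)])
          ⟨trNorm_nonneg _, htT.trans hT1⟩ ⟨hT0, hT1⟩ htT
    _ ≤ (T * (2 * m * Real.log 2) + Real.negMulLog T) / Real.log 2 := by
        gcongr
        exact log_two_pow_sub_one_add_one_le (by omega)
    _ = T * (2 * ((m + 1 : ℕ) - 1) - Real.logb 2 T) := by
        rw [Real.logb, Real.negMulLog]
        push_cast
        field_simp
        ring

theorem abs_vonNeumannEntropy_traceOutFrom_sub_le (hρ : IsDensityMatrix ρ)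
    (hσ : IsDensityMatrix σ) {i : ℕ} (hi : i ∈ Finset.Icc 2 n) :
    |vonNeumannEntropy (traceOutFrom i ρ) - vonNeumannEntropy (traceOutFrom i σ)| ≤
      trNorm (ρ - σ) * (2 * ((i : ℝ) - 1) - Real.logb 2 (trNorm (ρ - σ))) := by
  refine abs_sub_le_iff.2 ⟨hρ.vonNeumannEntropy_traceOutFrom_sub_le hσ hi, ?_⟩
  rw [trNorm_sub_comm]
  exact hσ.vonNeumannEntropy_traceOutFrom_sub_le hρ hi

theorem abs_averageEntropy_sub_le (hn : 2 ≤ n) (hρ : IsDensityMatrix ρ) (hσ : IsDensityMatrix σ) :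
    |averageEntropy ρ - averageEntropy σ| ≤
      trNorm (ρ - σ) * ((n : ℝ) - Real.logb 2 (trNorm (ρ - σ))) := by
  have hn1 : (0 : ℝ) < n - 1 := sub_pos.2 (by exact_mod_cast hn)
  set T := trNorm (ρ - σ)
  rw [averageEntropy, averageEntropy, ← mul_sub, ← Finset.sum_sub_distrib, abs_mul,
    abs_of_pos (by positivity), one_div, inv_mul_le_iff₀ hn1]
  calc |∑ i ∈ Finset.Icc 2 n, (vonNeumannEntropy (traceOutFrom i ρ) -
        vonNeumannEntropy (traceOutFrom i σ))|
      ≤ ∑ i ∈ Finset.Icc 2 n, T * (2 * ((i : ℝ) - 1) - Real.logb 2 T) :=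
        (Finset.abs_sum_le_sum_abs _ _).trans (Finset.sum_le_sum fun i hi =>
          hρ.abs_vonNeumannEntropy_traceOutFrom_sub_le hσ hi)
    _ = T * ((n - 1) * n - (n - 1) * Real.logb 2 T) := by
        rw [← Finset.mul_sum, Finset.sum_sub_distrib, sum_Icc_two_mul_sub_one (by omega),
          Finset.sum_const, Nat.card_Icc, nsmul_eq_mul, Nat.add_sub_add_right,
          Nat.cast_pred (by omega)]
    _ = (n - 1) * (T * (n - Real.logb 2 T)) := by ring

end IsDensityMatrix

theorem isDensityMatrix_ketbra (φ : Qustring n) : IsDensityMatrix (ketbra φ) where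
  posSemidef := Matrix.posSemidef_vecMulVec_self_star (φ : QubitSpace n).ofLp
  trace_eq_one := by
    have hnorm : ∑ x, ‖(φ : QubitSpace n) x‖ ^ 2 = 1 := by
      rw [← EuclideanSpace.norm_sq_eq, norm_eq_of_mem_sphere φ, one_pow]
    simp only [Matrix.trace, Matrix.diag, ketbra, Matrix.of_apply, RCLike.star_def,
      Complex.mul_conj']
    exact_mod_cast hnorm

end AverageEntropy

section Continuity

variable {ι : Type*} [Fintype ι] [DecidableEq ι]

open scoped Matrix.Norms.L2Operator in
theorem continuousOn_cfc_isHermitian {f : ℝ → ℝ} (hf : Continuous f) :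
    ContinuousOn (cfc f) {A : Matrix ι ι ℂ | A.IsHermitian} :=
  continuousOn_id.cfc_of_mem_nhdsSet (s := Set.univ) f (fun _ _ => by simp)
    (fun _ hA => hA.isSelfAdjoint) hf.continuousOn

theorem continuous_trNorm : Continuous (trNorm : Matrix ι ι ℂ → ℝ) := by
  have hcfc : Continuous fun X : Matrix ι ι ℂ => cfc Real.sqrt (Xᴴ * X) :=
    (continuousOn_cfc_isHermitian Real.continuous_sqrt).comp_continuous (by fun_prop)
      Matrix.isHermitian_conjTranspose_mul_self
  exact continuous_const.mul (Complex.continuous_re.comp hcfc.matrix_trace)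

theorem continuousOn_vonNeumannEntropy :
    ContinuousOn vonNeumannEntropy {ρ : Matrix ι ι ℂ | ρ.IsHermitian} := by
  refine ContinuousOn.congr ?_ fun ρ hρ => vonNeumannEntropy_eq_trace_cfc hρ
  exact ((Complex.continuous_re.comp continuous_id.matrix_trace).comp_continuousOn
    (continuousOn_cfc_isHermitian Real.continuous_negMulLog)).div_const _

variable {n : ℕ}

theorem continuous_traceOutFrom (i : ℕ) :
    Continuous (traceOutFrom i : Matrix (Fin n → Bool) (Fin n → Bool) ℂ → _) := by
  refine continuous_matrix fun x y => ?_
  simp only [traceOutFrom, partialTraceRight, Matrix.of_apply, Matrix.reindex_apply,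
    Matrix.submatrix_apply]
  fun_prop

theorem continuousOn_averageEntropy :
    ContinuousOn averageEntropy {ρ : Matrix (Fin n → Bool) (Fin n → Bool) ℂ | ρ.IsHermitian} :=
  continuousOn_const.mul <| continuousOn_finsetSum _ fun i _ =>
    continuousOn_vonNeumannEntropy.comp (continuous_traceOutFrom i).continuousOn
      fun _ hρ => isHermitian_traceOutFrom i hρ

theorem continuous_ketbra : Continuous (ketbra : Qustring n → _) := by
  refine continuous_matrix fun x y => ?_
  simp only [ketbra, Matrix.of_apply]
  fun_prop

theorem continuous_averageEntropy_ketbra :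
    Continuous fun φ : Qustring n => averageEntropy (ketbra φ) :=
  continuousOn_averageEntropy.comp_continuous continuous_ketbra fun φ =>
    (isDensityMatrix_ketbra φ).posSemidef.1

end Continuity

section Separability

variable {n k : ℕ}

theorem continuous_permuteQubits (σ : Equiv.Perm (Fin n)) : Continuous (permuteQubits σ) :=
  (PiLp.continuous_toLp 2 _).comp (continuous_pi fun y => by fun_prop)

theorem continuous_tensorBlocks (m : Fin k → ℕ) (hm : ∑ j, m j = n) :
    Continuous (tensorBlocks m hm) :=
  (PiLp.continuous_toLp 2 _).comp (continuous_pi fun y => by fun_prop)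

theorem isClosed_setOf_isKSeparable (n k : ℕ) : IsClosed {φ : Qustring n | IsKSeparable k φ} := by
  have : Finite {m : Fin k → ℕ // ∑ j, m j = n ∧ ∀ j, 1 ≤ m j} :=
    (Finset.piAntidiag Finset.univ n).finite_toSet.subset fun m hm => by simp [hm.1]
  have hunion : {φ : Qustring n | IsKSeparable k φ} =
      ⋃ (m : {m : Fin k → ℕ // ∑ j, m j = n ∧ ∀ j, 1 ≤ m j}) (σ : Equiv.Perm (Fin n)),
        (fun φ : Qustring n => permuteQubits σ φ) ⁻¹'
          Set.range fun ψ : ∀ j, Qustring (m.1 j) => tensorBlocks m.1 m.2.1 fun j => ψ j := by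
    ext φ
    simp only [IsKSeparable, Set.mem_ofPred_eq, Set.mem_iUnion, Set.mem_preimage, Set.mem_range]
    exact ⟨fun ⟨m, hm, ψ, σ, hpos, h⟩ => ⟨⟨m, hm, hpos⟩, σ, ψ, h.symm⟩,
      fun ⟨⟨m, hm, hpos⟩, σ, ψ, h⟩ => ⟨m, hm, ψ, σ, hpos, h.symm⟩⟩
  rw [hunion]
  refine isClosed_iUnion_of_finite fun m => isClosed_iUnion_of_finite fun σ => ?_
  have htensor : Continuous fun ψ : ∀ j, Qustring (m.1 j) =>
      tensorBlocks m.1 m.2.1 fun j => ψ j :=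
    (continuous_tensorBlocks m.1 m.2.1).comp (by fun_prop)
  exact (isCompact_range htensor).isClosed.preimage
    ((continuous_permuteQubits σ).comp continuous_subtype_val)

theorem tensorBlocks_single (m : Fin k → ℕ) (hm : ∑ j, m j = n) (x : Fin n → Bool) :
    tensorBlocks m hm (fun j =>
      EuclideanSpace.single (fun t => x (Fin.cast hm (finSigmaFinEquiv ⟨j, t⟩))) 1) =
      EuclideanSpace.single x 1 := by
  have hblocks (y : Fin n → Bool) :
      (∀ j, (fun t => y (Fin.cast hm (finSigmaFinEquiv ⟨j, t⟩))) =
        fun t => x (Fin.cast hm (finSigmaFinEquiv ⟨j, t⟩))) ↔ y = x := by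
    simp only [funext_iff]
    rw [← (finSigmaFinEquiv.trans (finCongr hm)).forall_congr_right, Sigma.forall]
    rfl
  ext y
  simp only [tensorBlocks, PiLp.single_apply, Fintype.prod_boole, hblocks]

theorem exists_pos_sum_eq (hk : 1 ≤ k) (hkn : k ≤ n) :
    ∃ m : Fin k → ℕ, ∑ j, m j = n ∧ ∀ j, 1 ≤ m j := by
  refine ⟨fun j => 1 + if j = ⟨0, hk⟩ then n - k else 0, ?_, fun j => Nat.le_add_right 1 _⟩
  rw [Finset.sum_add_distrib, Finset.sum_ite_eq' _ _ fun _ => n - k]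
  simp [hkn]

theorem exists_isKSeparable (hk : 1 ≤ k) (hkn : k ≤ n) : ∃ φ : Qustring n, IsKSeparable k φ := by
  obtain ⟨m, hm, hpos⟩ := exists_pos_sum_eq hk hkn
  let zeros (l : ℕ) : Qustring l := ⟨EuclideanSpace.single (fun _ => false) 1, by simp⟩
  exact ⟨zeros n, m, hm, fun j => zeros (m j), 1, hpos,
    (tensorBlocks_single m hm fun _ => false).symm⟩

theorem exists_isLeast_isKSeparable (hk : 1 ≤ k) (hkn : k ≤ n) {f : Qustring n → ℝ}
    (hf : Continuous f) :
    ∃ φ, IsKSeparable k φ ∧ IsLeast {d | ∃ χ, IsKSeparable k χ ∧ d = f χ} (f φ) := by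
  obtain ⟨φ, hφ, hmin⟩ := (isClosed_setOf_isKSeparable n k).isCompact.exists_isMinOn
    (exists_isKSeparable hk hkn) hf.continuousOn
  refine ⟨φ, hφ, ⟨φ, hφ, rfl⟩, ?_⟩
  rintro _ ⟨χ, hχ, rfl⟩
  exact hmin hχ

theorem exists_isKSeparable_trNorm_eq_sdis (hk : 1 ≤ k) (hkn : k ≤ n) (ξ : Qustring n) :
    ∃ φ, IsKSeparable k φ ∧ trNorm (ketbra ξ - ketbra φ) = sdis k ξ := by
  obtain ⟨φ, hφ, hleast⟩ := exists_isLeast_isKSeparable hk hkn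
    (continuous_trNorm.comp (continuous_const.sub continuous_ketbra) :
      Continuous fun φ => trNorm (ketbra ξ - ketbra φ))
  exact ⟨φ, hφ, hleast.csInf_eq.symm⟩

end Separability

theorem mainTheorem11_general (n : ℕ) (ξ : Qustring n) (k : ℕ) (hn : 2 ≤ n) (hk : 1 ≤ k)
    (hkn : k ≤ n) :
    ∃ δ : ℝ,
      IsLeast
        {d : ℝ | ∃ φ : Qustring n, IsKSeparable k φ ∧
          d = |averageEntropy (ketbra ξ) - averageEntropy (ketbra φ)|} δ ∧
      δ ≤ sdis k ξ * ((n : ℝ) - Real.logb 2 (sdis k ξ)) := by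
  obtain ⟨φ, -, hleast⟩ := exists_isLeast_isKSeparable hk hkn
    (continuous_const.sub continuous_averageEntropy_ketbra).abs
  obtain ⟨ψ, hψ, hsdis⟩ := exists_isKSeparable_trNorm_eq_sdis hk hkn ξ
  refine ⟨_, hleast, (hleast.2 ⟨ψ, hψ, rfl⟩).trans ?_⟩
  rw [← hsdis]
  exact (isDensityMatrix_ketbra ξ).abs_averageEntropy_sub_le hn (isDensityMatrix_ketbra ψ)

theorem mainTheorem11 (n : ℕ) (ξ : Qustring n) (k : ℕ) (hk2 : 2 ≤ k) (hkn : k ≤ n)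
    (hξ : sdis k ξ ≤ 1 / Real.exp 1) :
    ∃ δ : ℝ,
      IsLeast
        {d : ℝ | ∃ φ : Qustring n, IsKSeparable k φ ∧
          d = |averageEntropy (ketbra ξ) - averageEntropy (ketbra φ)|} δ ∧
      δ ≤ sdis k ξ * ((n : ℝ) - Real.logb 2 (sdis k ξ)) :=
  mainTheorem11_general n ξ k (hk2.trans hkn) (by omega) hkn
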